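/- Consider a finite set $\mathcal V$ of vehicles with positions $x_i[k]$, velocities $v_i[k]$ and inputs $u_i[k]$ obeying, for $k=0,1,2,\dots$, $$x_i[k+1]=x_i[k]+Tv_i[k]+\tfrac{T^2}{2}u_i[k],\qquad v_i[k+1]=v_i[k]+Tu_i[k],\qquad T>0 ,$$ which communicate over a time-varying digraph $\mathcal G[k]=(\mathcal V,\mathcal E[k])$, where $(j,i)\in\mathcal E[k]$ means that $i$ receives from $j$. Let $r\in\mathbb R$ be a desired velocity, let $\delta_{ij}$ be desired relative positions that are consistent, i.e. $\delta_{ij}+\delta_{jk}=\delta_{ik}$ for all $i,j,k$, and put $p_i[k]=x_i[k]-kTr$, $q_i[k]=v_i[k]-r$. Let $f\ge 0$ and $1\le \ell\le\tau$ be integers. *Neighbours.* Links that are up to $\tau$ steps old are used: $\mathcal N_i[k]=\{j : (j,i)\in\mathcal E[s]\text{ for some } s\ge 0,\ k-\tau\le s\le k\}$. *Malicious vehicles.* A set $\mathcal M\subseteq\mathcal V$ of vehicles is malicious: their inputs, and the values that they send to each receiver, are arbitrary. The other vehicles are normal. The $f$-total model says $|\mathcal M|\le f$; the $f$-local model says $|\mathcal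 N_i[k]\cap\mathcal M|\le f$ for every normal $i$ and every $k$. *Algorithm ADP-MSR.* Each normal vehicle $i$ applies $$u_i[k]=\sum_{j} a_{ij}[k]\bigl(\hat p_{ij}[k]-p_i[k]-\delta_{ij}\bigr)-\alpha_i q_i[k],$$ the sum being over the neighbours that are not ignored. When $i$ makes an update at time $k$, it has for each $j\in\mathcal N_i[k]$ a value $\hat p_{ij}[k]$, which for normal $j$ equals $p_j[k-\tau_{ij}[k]]$ with some delay $0\le\tau_{ij}[k]\le\min(\tau,k)$. With $z_j=\hat p_{ij}[k]-p_i[k]-\delta_{ij}$, it ignores all $j\in\mathcal N_i[k]$ with $z_j\ge0$ if there are fewer than $f$ of them, and otherwise $f$ neighbours with the largest $z_j$; it also ignores all $j\in\mathcal N_i[k]$ with $z_j\le 0$ if there are fewer than $f$ of them, and otherwise $f$ neighbours with the smallest $z_j$. At a time when $i$ makes no update, it keeps the non-ignored neighbours and their position values of the previous step (arbitrary ones before the first update). *Parameters.* There are $\gamma>0$ and $\sigma_i>0$ such that, for each normal $i$ and each $k$, every weight $a_{ij}[k]$ in the sum is at least $\gamma$ and these weights add up to at most $\sigma_i$; moreover,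 for all $i$, $T^2\sigma_i<1$ and $$2\sqrt{\sigma_i}-\tfrac{T\sigma_i}{2}\ \le\ \alpha_i\ \le\ \tfrac 2T-\tfrac{T\sigma_i}{2}.$$ *Partial asynchrony.* Each normal vehicle makes, for every $t\ge0$, at least one update at a time $k$ with $t+\ell-1\le k\le t+\tau$; that is, the links of any $\ell$ consecutive steps are available together in some update before any of them is more than $\tau$ steps old. *Robustness.* A digraph on $\mathcal V$ is $\rho$-robust if for all disjoint nonempty $\mathcal V_1,\mathcal V_2\subseteq\mathcal V$ some node of $\mathcal V_1$ or of $\mathcal V_2$ has at least $\rho$ in-neighbours outside the set $\mathcal V_1$, respectively $\mathcal V_2$, to which it belongs. **Claim.** Suppose that the $f$-total or the $f$-local malicious model holds, and that $\mathcal G[k]$ is jointly $(2f+1)$-robust with window $\ell\le\tau$: for every $t\ge0$ the union of $\mathcal G[t],\dots,\mathcal G[t+\ell-1]$ is $(2f+1)$-robust. Then the network achieves resilient coordinated movement: for every such set $\mathcal M$, every behaviour of the malicious vehicles and all initial states, $x_j[k]-x_i[k]\to\delta_{ij}$ and $v_i[k]\to r$ as $k\to\infty$, for all normal $i,j$. 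-/

import Mathlib

open Filter Topology

/-! ### Time-varying digraphs and robustness

`G.Adj j i` is the edge `(j, i)`: vehicle `i` receives from vehicle `j`. -/

/-- The nodes of `S` that have at least `r` incoming edges from outside `S`. -/
def reachableNodes {V : Type*} (G : Digraph V) (r : ℕ) (S : Set V) : Set V :=
  {i | i ∈ S ∧ r ≤ {j | j ∉ S ∧ G.Adj j i}.ncard}

/-- `(r, s)`-robustness of a digraph. -/
def IsRSRobust {V : Type*} (G : Digraph V) (r s : ℕ) : Prop :=
  ∀ S₁ S₂ : Set V, S₁.Nonempty → S₂.Nonempty → Disjoint S₁ S₂ →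
    reachableNodes G r S₁ = S₁ ∨ reachableNodes G r S₂ = S₂ ∨
      s ≤ (reachableNodes G r S₁).ncard + (reachableNodes G r S₂).ncard

/-- `r`-robustness is `(r, 1)`-robustness. -/
def IsRobust {V : Type*} (G : Digraph V) (r : ℕ) : Prop := IsRSRobust G r 1

/-- The union of the digraphs `G t, G (t + 1), …, G (t + ℓ - 1)`. -/
def unionOver {V : Type*} (G : ℕ → Digraph V) (t ℓ : ℕ) : Digraph V where
  Adj j i := ∃ s, t ≤ s ∧ s < t + ℓ ∧ (G s).Adj j i

/-- Joint `r`-robustness with window length `ℓ`: the union over every `ℓ` consecutive steps is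
`r`-robust. -/
def IsJointlyRobust {V : Type*} (G : ℕ → Digraph V) (r ℓ : ℕ) : Prop :=
  ∀ t, IsRobust (unionOver G t ℓ) r

open scoped Classical in
/-- The neighbours of vehicle `i` at time `k` when links that are up to `τ` steps old are used:
the `j` with `(j, i) ∈ E[s]` for some time `s` with `k - τ ≤ s ≤ k`. -/
noncomputable def neighborsAt {V : Type*} [Fintype V] (G : ℕ → Digraph V) (τ : ℕ) (i : V) (k : ℕ) :
    Finset V :=
  Finset.univ.filter fun j => ∃ s, s ≤ k ∧ k ≤ s + τ ∧ (G s).Adj j i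

/-! ### Malicious vehicles -/

/-- The `f`-total malicious model. -/
def IsFTotal {V : Type*} (f : ℕ) (M : Finset V) : Prop := M.card ≤ f

open scoped Classical in
/-- The `f`-local malicious model: at every time, every normal vehicle has at most `f` malicious
neighbours among those whose links it uses. -/
def IsFLocal {V : Type*} [Fintype V] (G : ℕ → Digraph V) (τ f : ℕ) (M : Finset V) : Prop :=
  ∀ i, i ∉ M → ∀ k, (neighborsAt G τ i k ∩ M).card ≤ f

/-! ### The filtering step -/

open scoped Classical in
/-- `R` is a possible set of vehicles ignored for having large relative positions: with `N` the
neighbours and `z j` the relative position of `j`, all vehicles with `0 ≤ z j` if there are fewer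
than `f` of them, and otherwise `f` vehicles with the largest values (ties broken arbitrarily). -/
def IsLargestIgnored {V : Type*} (f : ℕ) (N : Finset V) (z : V → ℝ) (R : Finset V) : Prop :=
  if (N.filter fun j => 0 ≤ z j).card < f then R = N.filter fun j => 0 ≤ z j
  else R ⊆ N ∧ R.card = f ∧ ∀ j ∈ R, ∀ l ∈ N, l ∉ R → z l ≤ z j

open scoped Classical in
/-- `R` is a possible set of vehicles ignored for having small relative positions. -/
def IsSmallestIgnored {V : Type*} (f : ℕ) (N : Finset V) (z : V → ℝ) (R : Finset V) : Prop :=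
  if (N.filter fun j => z j ≤ 0).card < f then R = N.filter fun j => z j ≤ 0
  else R ⊆ N ∧ R.card = f ∧ ∀ j ∈ R, ∀ l ∈ N, l ∉ R → z j ≤ z l

/-! ### Executions of the network -/

/-- All signals of a run of the network. -/
structure Execution (V : Type*) where
  /-- positions `x_i[k]` -/
  x : V → ℕ → ℝ
  /-- velocities `v_i[k]` -/
  v : V → ℕ → ℝ
  /-- control inputs `u_i[k]` -/
  u : V → ℕ → ℝ
  /-- the times at which vehicle `i` decides to make an update -/
  updates : V → Set ℕ
  /-- the delays `τ_ij[k]` -/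
  delay : V → V → ℕ → ℕ
  /-- `data i j k` is the (transformed) position of `j` with which `i` works at time `k` -/
  data : V → V → ℕ → ℝ
  /-- the neighbours of `i` that are not ignored at time `k` -/
  kept : V → ℕ → Finset V
  /-- the weights `a_ij[k]` of the edges that are not ignored -/
  a : V → V → ℕ → ℝ

namespace Execution

/-- The transformed position `p_i[k] = x_i[k] - k T r`. -/
def p {V : Type*} (E : Execution V) (T r : ℝ) (i : V) (k : ℕ) : ℝ := E.x i k - k * T * r

/-- The transformed velocity `q_i[k] = v_i[k] - r`. -/
def q {V : Type*} (E : Execution V) (r : ℝ) (i : V) (k : ℕ) : ℝ := E.v i k - r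

/-- The discretized double-integrator dynamics, obeyed by all vehicles. -/
def Dynamics {V : Type*} (E : Execution V) (T : ℝ) : Prop :=
  ∀ i k, E.x i (k + 1) = E.x i k + T * E.v i k + T ^ 2 / 2 * E.u i k ∧
    E.v i (k + 1) = E.v i k + T * E.u i k

/-- The control input of the normal vehicle `i`, with the ignored edges left out of the sum. -/
def ControlInput {V : Type*} (E : Execution V) (T r : ℝ) (α : V → ℝ) (δ : V → V → ℝ) (i : V) :
    Prop :=
  ∀ k, E.u i k = ∑ j ∈ E.kept i k, E.a i j k * (E.data i j k - E.p T r i k - δ i j)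
    - α i * E.q r i k

/-- What the normal vehicle `i` does at an update time `k`. From a normal neighbour it has the
position at time `k - τ_ij[k]`, where `τ_ij[k] ≤ τ`; the values that come from malicious neighbours
are arbitrary. It then ignores the extreme values. -/
def UpdateStep {V : Type*} [Fintype V] (E : Execution V) (G : ℕ → Digraph V) (M : Finset V)
    (f τ : ℕ) (T r : ℝ) (δ : V → V → ℝ) (i : V) (k : ℕ) : Prop :=
  (∀ j ∈ neighborsAt G τ i k, j ∉ M →
    E.delay i j k ≤ τ ∧ E.delay i j k ≤ k ∧ E.data i j k = E.p T r j (k - E.delay i j k)) ∧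
  ∃ R₁ R₂ : Finset V,
    IsLargestIgnored f (neighborsAt G τ i k) (fun j => E.data i j k - E.p T r i k - δ i j) R₁ ∧
    IsSmallestIgnored f (neighborsAt G τ i k) (fun j => E.data i j k - E.p T r i k - δ i j) R₂ ∧
    ∀ j, j ∈ E.kept i k ↔ j ∈ neighborsAt G τ i k ∧ j ∉ R₁ ∧ j ∉ R₂

/-- Without an update at time `k + 1`, vehicle `i` keeps the neighbours and their position values
of time `k`. -/
def HoldStep {V : Type*} (E : Execution V) (i : V) (k : ℕ) : Prop :=
  E.kept i (k + 1) = E.kept i k ∧ ∀ j ∈ E.kept i k, E.data i j (k + 1) = E.data i j k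

/-- The run follows the second-order dynamics, and every normal vehicle follows the ADP-MSR
algorithm with parameter `f`. Inputs of malicious vehicles and the values they send are arbitrary
(each receiver may be told something different), and so is the content of the memory of a normal
vehicle before its first update. -/
structure IsADPMSR {V : Type*} [Fintype V] (E : Execution V) (G : ℕ → Digraph V) (M : Finset V)
    (f τ : ℕ) (T r : ℝ) (α : V → ℝ) (δ : V → V → ℝ) : Prop where
  dynamics : E.Dynamics T
  control : ∀ i, i ∉ M → E.ControlInput T r α δ i
  update : ∀ i, i ∉ M → ∀ k ∈ E.updates i, E.UpdateStep G M f τ T r δ i k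
  hold : ∀ i, i ∉ M → ∀ k, k + 1 ∉ E.updates i → E.HoldStep i k

/-- The weights of the edges that normal vehicles use are at least `γ`, and those of the edges into
the normal vehicle `i` add up to at most `σ i`. -/
def WeightsBounded {V : Type*} (E : Execution V) (M : Finset V) (γ : ℝ) (σ : V → ℝ) : Prop :=
  ∀ i, i ∉ M → ∀ k, (∀ j ∈ E.kept i k, γ ≤ E.a i j k) ∧ ∑ j ∈ E.kept i k, E.a i j k ≤ σ i

/-- Partial asynchrony: the links that occur during any `ℓ` consecutive steps `t, …, t + ℓ - 1` are
available to each normal vehicle in an update which it makes after the last of these steps and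
before any of the links is more than `τ` steps old. For `ℓ = 1` this says that each normal vehicle
makes an update in any `τ + 1` consecutive steps. -/
def PartiallyAsynchronous {V : Type*} (E : Execution V) (M : Finset V) (ℓ τ : ℕ) : Prop :=
  ∀ i, i ∉ M → ∀ t, ∃ k ∈ E.updates i, t + ℓ ≤ k + 1 ∧ k ≤ t + τ

/-- The normal vehicles achieve coordinated movement with inter-vehicular distances `δ` and velocity
`r`. -/
def CoordinatedMovement {V : Type*} (E : Execution V) (M : Finset V) (δ : V → V → ℝ) (r : ℝ) :
    Prop :=
  (∀ i j, i ∉ M → j ∉ M → Tendsto (fun k => E.x j k - E.x i k) atTop (𝓝 (δ i j))) ∧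
    ∀ i, i ∉ M → Tendsto (fun k => E.v i k) atTop (𝓝 r)

end Execution

/-! Consistency gives δ_ij = d_j - d_i. With y_i = p_i - d_i and Q_i = T q_i the goal becomes: the
normal y_i reach consensus and the normal Q_i vanish. The feedback reads T² u_i = S (w_i - y_i) - A
Q_i with S = T² σ_i and A = T α_i, where w_i is an average of y_i and the retained data. The gain
conditions provide β_i > 0 such that y_i and η_i = y_i + β_i Q_i are both updated by convex
combinations of y_i, η_i and w_i (`exists_convex_coordinates`, `exists_mixes`). The second-order
system thus behaves like a first-order averaging network with two values per vehicle.

At most f malicious neighbours cannot push w_i above the normal positions of the last 2τ steps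
(`FilteredRun.safeAbove`), so upper bounds persist; lower bounds follow by negation. For
contraction, consider the normal vehicles near the top and those near the bottom of the range, with
margins that shrink by a fixed factor per step. A vehicle outside such a set never enters it. While
both sets are nonempty, robustness gives a member of one of them with 2f + 1 in-neighbours outside
its set, f + 1 of them normal, whose delayed values pull it out within 2τ + 1 steps
(`FilteredRun.isPulledDown`). After a bounded number of rounds one set is empty, and the range has
shrunk by a fixed factor (`MixingNetwork.exists_contraction`). Hence the y_i agree in the limit and
β_i Q_i = η_i - y_i tends to 0. -/

/-! ### The filtering step -/

/-- `K` consists of the members of `N` that survive the removal of `f` largest and `f` smallest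
relative positions `z`. -/
def IsFiltered {V : Type*} (f : ℕ) (N : Finset V) (z : V → ℝ) (K : Finset V) : Prop :=
  ∃ R₁ R₂ : Finset V, IsLargestIgnored f N z R₁ ∧ IsSmallestIgnored f N z R₂ ∧
    ∀ j, j ∈ K ↔ j ∈ N ∧ j ∉ R₁ ∧ j ∉ R₂

theorem isLargestIgnored_neg {V : Type*} {f : ℕ} {N : Finset V} {z : V → ℝ} {R : Finset V} :
    IsLargestIgnored f N (-z) R ↔ IsSmallestIgnored f N z R := by
  simp [IsLargestIgnored, IsSmallestIgnored]

theorem isSmallestIgnored_neg {V : Type*} {f : ℕ} {N : Finset V} {z : V → ℝ} {R : Finset V} :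
    IsSmallestIgnored f N (-z) R ↔ IsLargestIgnored f N z R := by
  simp [IsLargestIgnored, IsSmallestIgnored]

theorem IsFiltered.neg {V : Type*} {f : ℕ} {N : Finset V} {z : V → ℝ} {K : Finset V}
    (h : IsFiltered f N z K) : IsFiltered f N (-z) K := by
  obtain ⟨R₁, R₂, h₁, h₂, hK⟩ := h
  exact ⟨R₂, R₁, isLargestIgnored_neg.2 h₂, isSmallestIgnored_neg.2 h₁, fun j => by
    rw [hK]; tauto⟩

open scoped Classical in
theorem IsLargestIgnored.nonneg {V : Type*} {f : ℕ} {N : Finset V} {z : V → ℝ} {R : Finset V}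
    (h : IsLargestIgnored f N z R) {j : V} (hj : j ∈ R) : 0 ≤ z j := by
  unfold IsLargestIgnored at h
  split_ifs at h with hc
  · subst h
    exact (Finset.mem_filter.1 hj).2
  · obtain ⟨hRN, hcard, hR⟩ := h
    by_contra hneg
    -- At least `f` neighbours have `0 ≤ z` in this branch; a negative `z j` in `R` would force all
    -- of them into the other `f - 1` places.
    have hsub : N.filter (fun j => 0 ≤ z j) ⊆ R.erase j := by
      intro l hl
      obtain ⟨hlN, hl0⟩ := Finset.mem_filter.1 hl
      rw [Finset.mem_erase]
      refine ⟨fun h => hneg (h ▸ hl0), ?_⟩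
      by_contra hlR
      exact hneg (hl0.trans (hR j hj l hlN hlR))
    have := Finset.card_le_card hsub
    rw [Finset.card_erase_of_mem hj] at this
    have : 0 < R.card := Finset.card_pos.2 ⟨j, hj⟩
    omega

open scoped Classical in
theorem IsLargestIgnored.le_of_notMem {V : Type*} {f : ℕ} {N : Finset V} {z : V → ℝ}
    {R : Finset V} (h : IsLargestIgnored f N z R) {j l : V} (hj : j ∈ R) (hl : l ∈ N)
    (hlR : l ∉ R) : z l ≤ z j := by
  have h0 := h.nonneg hj
  unfold IsLargestIgnored at h
  split_ifs at h with hc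
  · subst h
    by_contra hlt
    exact hlR (Finset.mem_filter.2 ⟨hl, by linarith⟩)
  · exact h.2.2 j hj l hl hlR

theorem IsSmallestIgnored.card_le {V : Type*} {f : ℕ} {N : Finset V} {z : V → ℝ} {R : Finset V}
    (h : IsSmallestIgnored f N z R) : R.card ≤ f := by
  unfold IsSmallestIgnored at h
  split_ifs at h with hc
  · subst h
    exact hc.le
  · exact h.2.1.le

open scoped Classical in
/-- A surviving relative position is bounded above by `0` or by that of a normal neighbour. -/
theorem IsFiltered.nonpos_or_le {V : Type*} {f : ℕ} {N M : Finset V} {z : V → ℝ} {K : Finset V}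
    (h : IsFiltered f N z K) (hM : (N ∩ M).card ≤ f) {j : V} (hj : j ∈ K) :
    z j ≤ 0 ∨ ∃ l ∈ N, l ∉ M ∧ z j ≤ z l := by
  obtain ⟨R₁, R₂, h₁, -, hK⟩ := h
  obtain ⟨hjN, hj₁, -⟩ := (hK j).1 hj
  by_cases hjM : j ∈ M
  swap
  · exact Or.inr ⟨j, hjN, hjM, le_rfl⟩
  by_cases hz : z j ≤ 0
  · exact Or.inl hz
  have hle := fun l hl => h₁.le_of_notMem (j := l) (l := j) hl hjN hj₁
  unfold IsLargestIgnored at h₁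
  split_ifs at h₁ with hc
  · subst h₁
    exact absurd (Finset.mem_filter.2 ⟨hjN, (not_le.1 hz).le⟩) hj₁
  · obtain ⟨hRN, hcard, -⟩ := h₁
    right
    by_contra! hno
    -- Every member of `R₁` is at least `z j`; without a normal neighbour that high, `R₁` and `j`
    -- make `f + 1` malicious neighbours.
    have hsub : insert j R₁ ⊆ N ∩ M := by
      intro l hl
      rcases Finset.mem_insert.1 hl with rfl | hl
      · exact Finset.mem_inter.2 ⟨hjN, hjM⟩
      · refine Finset.mem_inter.2 ⟨hRN hl, ?_⟩
        by_contra hlM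
        exact absurd (hle l hl) (not_le.2 (hno l (hRN hl) hlM))
    have := Finset.card_le_card hsub
    rw [Finset.card_insert_of_notMem hj₁] at this
    omega

open scoped Classical in
/-- Among more than `f` neighbours, one survives or bounds everything that survives. -/
theorem IsFiltered.exists_mem_or_bound {V : Type*} {f : ℕ} {N : Finset V} {z : V → ℝ}
    {K Q : Finset V} (h : IsFiltered f N z K) (hQN : Q ⊆ N) (hQ : f < Q.card) :
    ∃ j ∈ Q, j ∈ K ∨ (0 ≤ z j ∧ ∀ l ∈ K, z l ≤ z j) := by
  obtain ⟨R₁, R₂, h₁, h₂, hK⟩ := h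
  -- At most `f` neighbours are removed from below, so some `j` in `Q` is not; if it is removed from
  -- above instead, it dominates all survivors.
  obtain ⟨j, hjQ, hj₂⟩ := Finset.exists_mem_notMem_of_card_lt_card (h₂.card_le.trans_lt hQ)
  refine ⟨j, hjQ, ?_⟩
  by_cases hj₁ : j ∈ R₁
  · refine Or.inr ⟨h₁.nonneg hj₁, fun l hl => ?_⟩
    obtain ⟨hlN, hl₁, -⟩ := (hK l).1 hl
    exact h₁.le_of_notMem hj₁ hlN hl₁
  · exact Or.inl ((hK j).2 ⟨hQN hjQ, hj₁, hj₂⟩)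

/-! ### Weighted averages -/

/-- The average of the values `D j`, `j ∈ K`, with weights `a j / σ`, the remaining weight being
given to `y`. -/
noncomputable def weightedAverage {V : Type*} (σ : ℝ) (K : Finset V) (a D : V → ℝ) (y : ℝ) : ℝ :=
  ((σ - ∑ j ∈ K, a j) * y + ∑ j ∈ K, a j * D j) / σ

theorem weightedAverage_neg {V : Type*} (σ : ℝ) (K : Finset V) (a D : V → ℝ) (y : ℝ) :
    weightedAverage σ K a (-D) (-y) = -weightedAverage σ K a D y := by
  simp only [weightedAverage, Pi.neg_apply, mul_neg, Finset.sum_neg_distrib]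
  ring

theorem sub_weightedAverage {V : Type*} {σ : ℝ} (hσ : 0 < σ) (K : Finset V) (a D : V → ℝ)
    (y B : ℝ) : B - weightedAverage σ K a D y =
      ((σ - ∑ j ∈ K, a j) * (B - y) + ∑ j ∈ K, a j * (B - D j)) / σ := by
  have : ∑ j ∈ K, a j * (B - D j) = (∑ j ∈ K, a j) * B - ∑ j ∈ K, a j * D j := by
    rw [Finset.sum_mul, ← Finset.sum_sub_distrib]
    exact Finset.sum_congr rfl fun _ _ => by ring
  rw [this, weightedAverage, eq_div_iff hσ.ne', sub_mul, div_mul_cancel₀ _ hσ.ne']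
  ring

theorem weightedAverage_le {V : Type*} {σ : ℝ} (hσ : 0 < σ) {K : Finset V} {a D : V → ℝ}
    {y B : ℝ} (ha : ∀ j ∈ K, 0 ≤ a j) (hs : ∑ j ∈ K, a j ≤ σ) (hy : y ≤ B)
    (hD : ∀ j ∈ K, D j ≤ B) : weightedAverage σ K a D y ≤ B := by
  rw [← sub_nonneg, sub_weightedAverage hσ]
  refine div_nonneg (add_nonneg (mul_nonneg (by linarith) (by linarith)) ?_) hσ.le
  exact Finset.sum_nonneg fun j hj => mul_nonneg (ha j hj) (sub_nonneg.2 (hD j hj))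

theorem weightedAverage_le_sub {V : Type*} {σ : ℝ} (hσ : 0 < σ) {K : Finset V} {a D : V → ℝ}
    {y B C γ : ℝ} (ha : ∀ j ∈ K, 0 ≤ a j) (hs : ∑ j ∈ K, a j ≤ σ) (hy : y ≤ C)
    (hD : ∀ j ∈ K, D j ≤ C) {l : V} (hl : l ∈ K) (hγ : γ ≤ a l) (hB : D l ≤ B) (hBC : B ≤ C) :
    weightedAverage σ K a D y ≤ C - γ / σ * (C - B) := by
  suffices γ / σ * (C - B) ≤ C - weightedAverage σ K a D y by linarith
  rw [sub_weightedAverage hσ, div_mul_eq_mul_div]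
  refine div_le_div_of_nonneg_right ?_ hσ.le
  have h1 : a l * (C - D l) ≤ ∑ j ∈ K, a j * (C - D j) :=
    Finset.single_le_sum (f := fun j => a j * (C - D j))
      (fun j hj => mul_nonneg (ha j hj) (sub_nonneg.2 (hD j hj))) hl
  have h2 : γ * (C - B) ≤ a l * (C - D l) :=
    mul_le_mul hγ (by linarith) (by linarith) (ha l hl)
  have h3 : 0 ≤ (σ - ∑ j ∈ K, a j) * (C - y) := mul_nonneg (by linarith) (by linarith)
  linarith

/-! ### Runs in relative coordinates -/

/-- The asynchronous filtering of delayed positions, in coordinates in which the desired relative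
positions vanish. -/
structure FilteredRun {V : Type*} [Fintype V] (G : ℕ → Digraph V) (M : Finset V) (f τ : ℕ)
    (updates : V → Set ℕ) (delay : V → V → ℕ → ℕ) (kept : V → ℕ → Finset V)
    (y : V → ℕ → ℝ) (dat : V → V → ℕ → ℝ) : Prop where
  received : ∀ i, i ∉ M → ∀ k ∈ updates i, ∀ j ∈ neighborsAt G τ i k, j ∉ M →
    delay i j k ≤ τ ∧ delay i j k ≤ k ∧ dat i j k = y j (k - delay i j k)
  filtered : ∀ i, i ∉ M → ∀ k ∈ updates i,
    IsFiltered f (neighborsAt G τ i k) (fun j => dat i j k - y i k) (kept i k)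
  hold : ∀ i, i ∉ M → ∀ k, k + 1 ∉ updates i →
    kept i (k + 1) = kept i k ∧ ∀ j ∈ kept i k, dat i j (k + 1) = dat i j k

section Run

variable {V : Type*} [Fintype V] {G : ℕ → Digraph V} {M : Finset V} {f τ : ℕ}
  {updates : V → Set ℕ} {delay : V → V → ℕ → ℕ} {kept : V → ℕ → Finset V}
  {y : V → ℕ → ℝ} {dat : V → V → ℕ → ℝ}

theorem FilteredRun.neg (h : FilteredRun G M f τ updates delay kept y dat) :
    FilteredRun G M f τ updates delay kept (-y) (-dat) where
  received i hi k hk j hj hjM := by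
    obtain ⟨h₁, h₂, h₃⟩ := h.received i hi k hk j hj hjM
    exact ⟨h₁, h₂, by simp [h₃]⟩
  filtered i hi k hk := by
    have := (h.filtered i hi k hk).neg
    convert this using 1
    funext j
    simp only [Pi.neg_apply]
    ring
  hold i hi k hk := by
    obtain ⟨h₁, h₂⟩ := h.hold i hi k hk
    exact ⟨h₁, fun j hj => by simp [h₂ j hj]⟩

open scoped Classical in
/-- At an update, what survives is bounded by recent positions of normal vehicles. -/
theorem FilteredRun.dat_le_of_update (h : FilteredRun G M f τ updates delay kept y dat)
    (hM : IsFLocal G τ f M) {i : V} (hi : i ∉ M) {k : ℕ} (hk : k ∈ updates i) {B : ℝ}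
    (hB : ∀ j, j ∉ M → ∀ s, s ≤ k → k ≤ s + τ → y j s ≤ B) {j : V} (hj : j ∈ kept i k) :
    dat i j k ≤ B := by
  rcases (h.filtered i hi k hk).nonpos_or_le (hM i hi k) hj with hz | ⟨l, hl, hlM, hz⟩
  · have := hB i hi k le_rfl (by omega)
    linarith
  · obtain ⟨h₁, h₂, h₃⟩ := h.received i hi k hk l hl hlM
    have := hB l hlM (k - delay i l k) (by omega) (by omega)
    linarith

theorem FilteredRun.hold_until (h : FilteredRun G M f τ updates delay kept y dat)
    {i : V} (hi : i ∉ M) {k : ℕ} (n : ℕ) (hn : ∀ s, k < s → s ≤ k + n → s ∉ updates i) :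
    kept i (k + n) = kept i k ∧ ∀ j ∈ kept i k, dat i j (k + n) = dat i j k := by
  induction n with
  | zero => simp
  | succ n ih =>
    obtain ⟨h₁, h₂⟩ := ih fun s hs hs' => hn s hs (by omega)
    obtain ⟨h₃, h₄⟩ := h.hold i hi (k + n) (hn _ (by omega) (by omega))
    exact ⟨h₃.trans h₁, fun j hj => (h₄ j (h₁ ▸ hj)).trans (h₂ j hj)⟩

/-- Data in use date from the last update, at most `τ` steps ago, and were at most `τ` steps old
then: hence the horizon `2 * τ`. The condition `τ ≤ k` ensures that an update has taken place. -/
theorem FilteredRun.dat_le (h : FilteredRun G M f τ updates delay kept y dat)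
    (hM : IsFLocal G τ f M) {i : V} (hi : i ∉ M)
    (hup : ∀ t, ∃ k ∈ updates i, t ≤ k ∧ k ≤ t + τ) {k : ℕ} (hk : τ ≤ k) {B : ℝ}
    (hB : ∀ j, j ∉ M → ∀ s, s ≤ k → k ≤ s + 2 * τ → y j s ≤ B) {j : V} (hj : j ∈ kept i k) :
    dat i j k ≤ B := by
  classical
  obtain ⟨k₀, hk₀, hle, hle'⟩ := hup (k - τ)
  have hk₀k : k₀ ≤ k := by omega
  obtain ⟨k₁, hmem, hge, hk₁k, hlast⟩ : ∃ k₁ ∈ updates i, k₀ ≤ k₁ ∧ k₁ ≤ k ∧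
      ∀ s, k₁ < s → s ≤ k → s ∉ updates i :=
    ⟨Nat.findGreatest (· ∈ updates i) k, Nat.findGreatest_spec (P := (· ∈ updates i)) hk₀k hk₀,
      Nat.le_findGreatest hk₀k hk₀, Nat.findGreatest_le k,
      fun s hs hs' => Nat.findGreatest_is_greatest hs hs'⟩
  obtain ⟨n, rfl⟩ := Nat.exists_eq_add_of_le hk₁k
  obtain ⟨h₁, h₂⟩ := h.hold_until hi n hlast
  rw [h₁] at hj
  rw [h₂ j hj]
  exact h.dat_le_of_update hM hi hmem (fun l hl s hs hs' => hB l hl s (by omega) (by omega)) hj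

/-- The weighted average used by `i` never exceeds the recent positions of normal vehicles. -/
def SafeAbove {V : Type*} (M : Finset V) (τ : ℕ) (y w : V → ℕ → ℝ) : Prop :=
  ∀ i, i ∉ M → ∀ k, τ ≤ k → ∀ B,
    (∀ j, j ∉ M → ∀ s, s ≤ k → k ≤ s + 2 * τ → y j s ≤ B) → w i k ≤ B

/-- If the normal vehicles outside `S` stay below `B` during `[k, k']` then the average that `i`
uses at time `k'` is pulled towards `B`. -/
def IsPulledDown {V : Type*} (M : Finset V) (τ : ℕ) (φ : ℝ) (y w : V → ℕ → ℝ) (S : Set V)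
    (k k' : ℕ) (i : V) : Prop :=
  ∀ B C, B ≤ C → (∀ j, j ∉ M → j ∉ S → ∀ s, k ≤ s → s ≤ k' → y j s ≤ B) →
    (∀ j, j ∉ M → ∀ s, s ≤ k' → k' ≤ s + 2 * τ → y j s ≤ C) → w i k' ≤ C - φ * (C - B)

theorem FilteredRun.safeAbove (h : FilteredRun G M f τ updates delay kept y dat)
    (hM : IsFLocal G τ f M) {a : V → V → ℕ → ℝ} {σ : V → ℝ} (hσ : ∀ i, 0 < σ i)
    (ha : ∀ i, i ∉ M → ∀ k, ∀ j ∈ kept i k, 0 ≤ a i j k)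
    (hs : ∀ i, i ∉ M → ∀ k, ∑ j ∈ kept i k, a i j k ≤ σ i)
    (hup : ∀ i, i ∉ M → ∀ t, ∃ k ∈ updates i, t ≤ k ∧ k ≤ t + τ) :
    SafeAbove M τ y fun i k =>
      weightedAverage (σ i) (kept i k) (fun j => a i j k) (fun j => dat i j k) (y i k) := by
  intro i hi k hk B hB
  exact weightedAverage_le (hσ i) (ha i hi k) (hs i hi k) (hB i hi k le_rfl (by omega))
    fun j hj => h.dat_le hM hi (hup i hi) hk hB hj

theorem FilteredRun.isPulledDown (h : FilteredRun G M f τ updates delay kept y dat)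
    (hM : IsFLocal G τ f M) {a : V → V → ℕ → ℝ} {σ : V → ℝ} (hσ : ∀ i, 0 < σ i) {γ φ : ℝ}
    (hγ : 0 < γ) (hφ : ∀ i, φ ≤ γ / σ i) (hφ1 : φ ≤ 1)
    (ha : ∀ i, i ∉ M → ∀ k, ∀ j ∈ kept i k, γ ≤ a i j k)
    (hs : ∀ i, i ∉ M → ∀ k, ∑ j ∈ kept i k, a i j k ≤ σ i)
    {S : Set V} {k k' : ℕ} (hkk : k + τ ≤ k') {i : V} (hi : i ∉ M) (hk' : k' ∈ updates i)
    {Q : Finset V} (hQN : Q ⊆ neighborsAt G τ i k') (hQ : 2 * f < Q.card) (hQS : ∀ j ∈ Q, j ∉ S) :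
    IsPulledDown M τ φ y (fun i k =>
      weightedAverage (σ i) (kept i k) (fun j => a i j k) (fun j => dat i j k) (y i k))
      S k k' i := by
  classical
  intro B C hBC hB hC
  have hcard : f < (Q \ M).card := by
    have h₁ : (Q ∩ M).card ≤ f :=
      (Finset.card_le_card (Finset.inter_subset_inter_right hQN)).trans (hM i hi k')
    have h₂ := Finset.card_sdiff_add_card_inter Q M
    omega
  have hyC := hC i hi k' le_rfl (by omega)
  have hDC : ∀ j ∈ kept i k', dat i j k' ≤ C := fun j hj =>
    h.dat_le_of_update hM hi hk' (fun l hl s hs₁ hs₂ => hC l hl s hs₁ (by omega)) hj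
  have ha0 : ∀ j ∈ kept i k', 0 ≤ a i j k' := fun j hj => hγ.le.trans (ha i hi k' j hj)
  obtain ⟨j, hjQ, hj⟩ := (h.filtered i hi k' hk').exists_mem_or_bound
    (Finset.sdiff_subset.trans hQN) hcard
  obtain ⟨hjQ, hjM⟩ := Finset.mem_sdiff.1 hjQ
  obtain ⟨h₁, h₂, h₃⟩ := h.received i hi k' hk' j (hQN hjQ) hjM
  have hjB : dat i j k' ≤ B := h₃ ▸ hB j hjM (hQS j hjQ) _ (by omega) (by omega)
  rcases hj with hj | ⟨hj₀, hj⟩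
  · refine (weightedAverage_le_sub (hσ i) ha0 (hs i hi k') hyC hDC hj (ha i hi k' j hj) hjB
      hBC).trans ?_
    have := mul_le_mul_of_nonneg_right (hφ i) (sub_nonneg.2 hBC)
    linarith
  -- Here `j` was removed from above: it bounds `y i` and all survivors, so the whole average is at
  -- most `B`.
  · have : weightedAverage (σ i) (kept i k') (fun j => a i j k') (fun j => dat i j k') (y i k')
        ≤ B := weightedAverage_le (hσ i) ha0 (hs i hi k') (by linarith)
          fun l hl => by have := hj l hl; linarith
    have h' := mul_le_mul_of_nonneg_right hφ1 (sub_nonneg.2 hBC)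
    simp only
    linarith

end Run

/-! ### Malicious models and robustness of unions -/

theorem IsFTotal.isFLocal {V : Type*} [Fintype V] {G : ℕ → Digraph V} {τ f : ℕ} {M : Finset V}
    (h : IsFTotal f M) : IsFLocal G τ f M  := by
  classical
  exact fun _ _ _ => (Finset.card_le_card Finset.inter_subset_right).trans h

/-- Robustness yields a node with many incoming edges from outside its set. -/
theorem IsRobust.exists_mem {V : Type*} {G : Digraph V} {r : ℕ} (h : IsRobust G r)
    {S₁ S₂ : Set V} (h₁ : S₁.Nonempty) (h₂ : S₂.Nonempty) (hd : Disjoint S₁ S₂) :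
    (∃ i ∈ S₁, r ≤ {j | j ∉ S₁ ∧ G.Adj j i}.ncard) ∨
      ∃ i ∈ S₂, r ≤ {j | j ∉ S₂ ∧ G.Adj j i}.ncard := by
  rcases h S₁ S₂ h₁ h₂ hd with h | h | h
  · obtain ⟨i, hi⟩ := h₁
    exact Or.inl ⟨i, hi, (h.symm.subset hi).2⟩
  · obtain ⟨i, hi⟩ := h₂
    exact Or.inr ⟨i, hi, (h.symm.subset hi).2⟩
  · by_cases h0 : (reachableNodes G r S₁).ncard = 0
    · obtain ⟨i, hi⟩ := Set.nonempty_of_ncard_ne_zero (s := reachableNodes G r S₂) (by omega)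
      exact Or.inr ⟨i, hi.1, hi.2⟩
    · obtain ⟨i, hi⟩ := Set.nonempty_of_ncard_ne_zero h0
      exact Or.inl ⟨i, hi.1, hi.2⟩

open scoped Classical in
/-- In-neighbours in a union over a window are neighbours at an update shortly after it. -/
theorem exists_subset_neighborsAt {V : Type*} [Fintype V] {G : ℕ → Digraph V} {t ℓ τ r k : ℕ}
    {S : Set V} {i : V} (h : r ≤ {j | j ∉ S ∧ (unionOver G t ℓ).Adj j i}.ncard)
    (hk : t + ℓ ≤ k + 1) (hk' : k ≤ t + τ) :
    ∃ Q ⊆ neighborsAt G τ i k, r ≤ Q.card ∧ ∀ j ∈ Q, j ∉ S := by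
  refine ⟨{j | j ∉ S ∧ (unionOver G t ℓ).Adj j i}.toFinset, fun j hj => ?_, ?_, fun j hj => ?_⟩
  · obtain ⟨-, s, hs, hs', hadj⟩ := Set.mem_toFinset.1 hj
    simp only [neighborsAt, Finset.mem_filter, Finset.mem_univ, true_and]
    exact ⟨s, by omega, by omega, hadj⟩
  · rwa [← Set.ncard_eq_toFinset_card']
  · exact (Set.mem_toFinset.1 hj).1

/-! ### Contraction of the range -/

/-- Upper bounds on a pair `(y, η)` and on the input `w` are passed on to the next step: each of
the gaps `ε` and `ε'` below a common bound `B` survives up to the factor `θ`. -/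
def Mixes (θ : ℝ) (y η w : ℕ → ℝ) : Prop :=
  ∀ k B ε ε', 0 ≤ ε → 0 ≤ ε' → y k ≤ B - ε → η k ≤ B - ε → w k ≤ B - ε' →
    y (k + 1) ≤ B - θ * (ε + ε') ∧ η (k + 1) ≤ B - θ * (ε + ε')

/-- A network of pairs `(y i, η i)` driven by the averages `w i`. -/
structure MixingNetwork {V : Type*} (M : Finset V) (τ : ℕ) (θ φ : ℝ) (y η w : V → ℕ → ℝ) :
    Prop where
  mixes : ∀ i, i ∉ M → Mixes θ (y i) (η i) (w i)
  mixes_neg : ∀ i, i ∉ M → Mixes θ (-y i) (-η i) (-w i)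
  safe : SafeAbove M τ y w
  safe_neg : SafeAbove M τ (-y) (-w)
  pull : ∀ S₁ S₂ : Set V, S₁ ⊆ {i | i ∉ M} → S₂ ⊆ {i | i ∉ M} → S₁.Nonempty → S₂.Nonempty →
    Disjoint S₁ S₂ → ∀ k, ∃ k' i, k ≤ k' ∧ k' ≤ k + 2 * τ ∧
      (i ∈ S₁ ∧ IsPulledDown M τ φ y w S₁ k k' i ∨
        i ∈ S₂ ∧ IsPulledDown M τ φ (-y) (-w) S₂ k k' i)

/-- The normal vehicles with `y i k` or `η i k` above `B`. -/
def aboveSet {V : Type*} (M : Finset V) (y η : V → ℕ → ℝ) (B : ℝ) (k : ℕ) : Set V :=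
  {i | i ∉ M ∧ (B < y i k ∨ B < η i k)}

theorem le_of_notMem_aboveSet {V : Type*} {M : Finset V} {y η : V → ℕ → ℝ} {B : ℝ} {k : ℕ} {i : V}
    (hi : i ∉ M) (h : i ∉ aboveSet M y η B k) : y i k ≤ B ∧ η i k ≤ B := by
  by_contra hc
  exact h ⟨hi, by by_contra! hle; exact hc hle⟩

/-- From time `k` on, all `y i` and `η i` of normal vehicles are at most `B`. -/
def EventuallyLE {V : Type*} (M : Finset V) (y η : V → ℕ → ℝ) (B : ℝ) (k : ℕ) : Prop :=
  ∀ i, i ∉ M → ∀ s, k ≤ s → y i s ≤ B ∧ η i s ≤ B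

/-! ### Persistence of bounds and shrinking of the extreme sets -/

namespace MixingNetwork

variable {V : Type*} {M : Finset V} {τ : ℕ} {θ φ : ℝ} {y η w : V → ℕ → ℝ}

theorem neg (h : MixingNetwork M τ θ φ y η w) : MixingNetwork M τ θ φ (-y) (-η) (-w) where
  mixes := h.mixes_neg
  mixes_neg i hi := by simpa using h.mixes i hi
  safe := h.safe_neg
  safe_neg := by simpa using h.safe
  pull S₁ S₂ h₁ h₂ hn₁ hn₂ hd k := by
    obtain ⟨k', i, hk, hk', hi⟩ := h.pull S₂ S₁ h₂ h₁ hn₂ hn₁ hd.symm k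
    exact ⟨k', i, hk, hk', by simpa using hi.symm⟩

/-- Inputs look back at most `2 * τ` steps, so a bound over a full window reproduces itself through
`mixes` with zero gaps. -/
theorem eventuallyLE_of_window (h : MixingNetwork M τ θ φ y η w) {B : ℝ} {k : ℕ}
    (hB : ∀ i, i ∉ M → ∀ s, k ≤ s → s ≤ k + 2 * τ → y i s ≤ B ∧ η i s ≤ B) :
    EventuallyLE M y η B k := by
  suffices ∀ n s, k ≤ s → s ≤ k + 2 * τ + n → ∀ i, i ∉ M → y i s ≤ B ∧ η i s ≤ B from
    fun i hi s hs => this s s hs (by omega) i hi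
  intro n
  induction n with
  | zero => exact fun s hs hs' i hi => hB i hi s hs hs'
  | succ n ih =>
    intro s hs hs' i hi
    rcases Nat.lt_or_ge (k + 2 * τ + n) s with hlt | hle
    · obtain rfl : s = k + 2 * τ + n + 1 := by omega
      have h₀ := ih (k + 2 * τ + n) (by omega) le_rfl i hi
      have hw := h.safe i hi (k + 2 * τ + n) (by omega) B
        fun j hj s hs₁ hs₂ => (ih s (by omega) hs₁ j hj).1
      simpa using h.mixes i hi (k + 2 * τ + n) B 0 0 le_rfl le_rfl (by simpa using h₀.1)
        (by simpa using h₀.2) (by simpa using hw)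
    · exact ih s hs hle i hi

theorem input_le (h : MixingNetwork M τ θ φ y η w) {B : ℝ} {k : ℕ}
    (hB : EventuallyLE M y η B k) {i : V} (hi : i ∉ M) {s : ℕ} (hs : k + 2 * τ ≤ s) :
    w i s ≤ B :=
  h.safe i hi s (by omega) B fun j hj s' _ hs' => (hB j hj s' (by omega)).1

/-- A gap `E` survives up to the factor `θ` under any input below `B`. The further factor `φ` is
given away so that one rate `θ * φ` also serves the vehicles that are pulled. -/
theorem aboveSet_succ_subset (h : MixingNetwork M τ θ φ y η w) (hθ : 0 ≤ θ) (hφ : φ ≤ 1)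
    {B E : ℝ} (hE : 0 ≤ E) {k : ℕ} (hB : EventuallyLE M y η B k) {s : ℕ} (hs : k + 2 * τ ≤ s) :
    aboveSet M y η (B - θ * φ * E) (s + 1) ⊆ aboveSet M y η (B - E) s := by
  rintro i ⟨hi, hlt⟩
  refine ⟨hi, ?_⟩
  by_contra! hle
  have hstep := h.mixes i hi s B E 0 hE le_rfl hle.1 hle.2 (by simpa using h.input_le hB hi hs)
  have hmul : θ * φ * E ≤ θ * (E + 0) := by
    have := mul_le_mul_of_nonneg_right (mul_le_of_le_one_right hθ hφ) hE
    linarith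
  rcases hlt with hlt | hlt
  · linarith [hstep.1]
  · linarith [hstep.2]

/-- The normal vehicles that at time `k₀ + n` are above `B` minus a margin shrinking with `n`. -/
def highSet (M : Finset V) (y η : V → ℕ → ℝ) (κ B E : ℝ) (k₀ n : ℕ) : Set V :=
  aboveSet M y η (B - κ ^ n * E) (k₀ + n)

theorem highSet_antitone (h : MixingNetwork M τ θ φ y η w) (hθ : 0 < θ) (hφ : 0 < φ)
    (hφ1 : φ ≤ 1) {B E : ℝ} (hE : 0 ≤ E) {k : ℕ} (hB : EventuallyLE M y η B k) :
    Antitone (highSet M y η (θ * φ) B E (k + 2 * τ)) := by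
  refine antitone_nat_of_succ_le fun n => ?_
  have := h.aboveSet_succ_subset hθ.le hφ1 (E := (θ * φ) ^ n * E) (by positivity) hB
    (s := k + 2 * τ + n) (by omega)
  rwa [← mul_assoc, ← pow_succ'] at this

/-- Vehicles outside the set keep the margin `(θ * φ) ^ m * E`; the pull passes the fraction `φ` of
it to the input, and mixing passes `θ` of that to both components, which is exactly the next margin.
-/
theorem notMem_highSet_of_isPulledDown (h : MixingNetwork M τ θ φ y η w) (hθ : 0 < θ)
    (hθ1 : θ ≤ 1) (hφ : 0 < φ) (hφ1 : φ ≤ 1) {B E : ℝ} (hE : 0 ≤ E) {k : ℕ}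
    (hB : EventuallyLE M y η B k) {n m : ℕ} (hnm : n ≤ m) {i : V}
    (hi : IsPulledDown M τ φ y w (highSet M y η (θ * φ) B E (k + 2 * τ) n) (k + 2 * τ + n)
      (k + 2 * τ + m) i) :
    i ∉ highSet M y η (θ * φ) B E (k + 2 * τ) (m + 1) := by
  rintro ⟨hiM, hlt⟩
  have hκ1 : θ * φ ≤ 1 := mul_le_one₀ hθ1 hφ.le hφ1
  have hpos : 0 ≤ (θ * φ) ^ m * E := by positivity
  have hw := hi (B - (θ * φ) ^ m * E) B (by linarith) (fun j hj hjS s hs hs' => by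
    obtain ⟨l, rfl⟩ := Nat.exists_eq_add_of_le (show k + 2 * τ ≤ s by omega)
    have h₁ := le_of_notMem_aboveSet hj fun hmem =>
      hjS (h.highSet_antitone hθ hφ hφ1 hE hB (show n ≤ l by omega) hmem)
    have h₂ : (θ * φ) ^ m ≤ (θ * φ) ^ l :=
      pow_le_pow_of_le_one (by positivity) hκ1 (by omega)
    have h₃ := mul_le_mul_of_nonneg_right h₂ hE
    linarith [h₁.1]) (fun j hj s hs hs' => (hB j hj s (by omega)).1)
  have h₀ := hB i hiM (k + 2 * τ + m) (by omega)
  have hstep := h.mixes i hiM (k + 2 * τ + m) B 0 (φ * ((θ * φ) ^ m * E)) le_rfl (by positivity)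
    (by simpa using h₀.1) (by simpa using h₀.2) (by simpa using hw)
  have heq : θ * (0 + φ * ((θ * φ) ^ m * E)) = (θ * φ) ^ (m + 1) * E := by ring
  rw [heq] at hstep
  rw [← add_assoc] at hlt
  rcases hlt with hlt | hlt
  · linarith [hstep.1]
  · linarith [hstep.2]

/-- This makes the high and the low set disjoint: `y i` and `η i` may start at opposite ends of the
range, but after one step both have felt the same input, which lies on one side of the midpoint. -/
theorem notMem_highSet_one (h : MixingNetwork M τ θ φ y η w) (hθ : 0 < θ) (hφ1 : φ ≤ 1)
    {B E : ℝ} (hE : 0 ≤ E) {k : ℕ} (hB : EventuallyLE M y η B k) {i : V}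
    (hw : w i (k + 2 * τ) ≤ B - E) : i ∉ highSet M y η (θ * φ) B E (k + 2 * τ) 1 := by
  rintro ⟨hi, hlt⟩
  have h₀ := hB i hi (k + 2 * τ) (by omega)
  have hstep := h.mixes i hi (k + 2 * τ) B 0 E le_rfl hE (by simpa using h₀.1)
    (by simpa using h₀.2) hw
  have hmul := mul_le_mul_of_nonneg_right (mul_le_of_le_one_right hθ.le hφ1) hE
  rw [pow_one] at hlt
  rcases hlt with hlt | hlt
  · linarith [hstep.1]
  · linarith [hstep.2]

/-- If no vehicle is high any more then the upper bound has decreased. -/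
theorem eventuallyLE_of_highSet_eq_empty (h : MixingNetwork M τ θ φ y η w) (hθ : 0 < θ)
    (hθ1 : θ ≤ 1) (hφ : 0 < φ) (hφ1 : φ ≤ 1) {B E : ℝ} (hE : 0 ≤ E) {k : ℕ}
    (hB : EventuallyLE M y η B k) {n : ℕ}
    (hn : highSet M y η (θ * φ) B E (k + 2 * τ) n = ∅) :
    EventuallyLE M y η (B - (θ * φ) ^ (n + 2 * τ) * E) (k + 2 * τ + n) := by
  refine h.eventuallyLE_of_window fun i hi s hs hs' => ?_
  obtain ⟨l, rfl⟩ := Nat.exists_eq_add_of_le (show k + 2 * τ ≤ s by omega)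
  have hil : i ∉ highSet M y η (θ * φ) B E (k + 2 * τ) l := fun hmem => by
    have := h.highSet_antitone hθ hφ hφ1 hE hB (show n ≤ l by omega) hmem
    rw [hn] at this
    exact this
  have h₁ := le_of_notMem_aboveSet hi hil
  have h₂ : (θ * φ) ^ (n + 2 * τ) ≤ (θ * φ) ^ l :=
    pow_le_pow_of_le_one (by positivity) (mul_le_one₀ hθ1 hφ.le hφ1) (by omega)
  have h₃ := mul_le_mul_of_nonneg_right h₂ hE
  exact ⟨by linarith [h₁.1], by linarith [h₁.2]⟩

/-- After sufficiently many rounds no vehicle is high or no vehicle is low. -/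
theorem highSet_eq_empty_or [Fintype V] (h : MixingNetwork M τ θ φ y η w) (hθ : 0 < θ)
    (hθ1 : θ ≤ 1) (hφ : 0 < φ) (hφ1 : φ ≤ 1) {hi lo E : ℝ} (hE : 0 ≤ E) {k : ℕ}
    (hhi : EventuallyLE M y η hi k) (hlo : EventuallyLE M (-y) (-η) (-lo) k) (c n : ℕ)
    (hd : Disjoint (highSet M y η (θ * φ) hi E (k + 2 * τ) n)
      (highSet M (-y) (-η) (θ * φ) (-lo) E (k + 2 * τ) n))
    (hc : (highSet M y η (θ * φ) hi E (k + 2 * τ) n).ncard +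
      (highSet M (-y) (-η) (θ * φ) (-lo) E (k + 2 * τ) n).ncard ≤ c) :
    highSet M y η (θ * φ) hi E (k + 2 * τ) (n + c * (2 * τ + 1)) = ∅ ∨
      highSet M (-y) (-η) (θ * φ) (-lo) E (k + 2 * τ) (n + c * (2 * τ + 1)) = ∅ := by
  have hH := h.highSet_antitone hθ hφ hφ1 hE hhi
  have hL := h.neg.highSet_antitone hθ hφ hφ1 hE hlo
  induction c generalizing n with
  | zero =>
    left
    rw [zero_mul, add_zero]
    exact (Set.ncard_eq_zero (Set.toFinite _)).1 (by omega)
  | succ c ih =>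
    have hle : n ≤ n + (c + 1) * (2 * τ + 1) := Nat.le_add_right _ _
    rcases Set.eq_empty_or_nonempty (highSet M y η (θ * φ) hi E (k + 2 * τ) n) with h₁ | h₁
    · exact Or.inl (Set.subset_empty_iff.1 (h₁ ▸ hH hle))
    rcases Set.eq_empty_or_nonempty (highSet M (-y) (-η) (θ * φ) (-lo) E (k + 2 * τ) n)
      with h₂ | h₂
    · exact Or.inr (Set.subset_empty_iff.1 (h₂ ▸ hL hle))
    have hle' : n ≤ n + (2 * τ + 1) := Nat.le_add_right _ _
    have hstep : n + (c + 1) * (2 * τ + 1) = n + (2 * τ + 1) + c * (2 * τ + 1) := by ring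
    rw [hstep]
    refine ih (n + (2 * τ + 1)) (hd.mono (hH hle') (hL hle')) ?_
    have hcH := Set.ncard_le_ncard (hH hle') (Set.toFinite _)
    have hcL := Set.ncard_le_ncard (hL hle') (Set.toFinite _)
    obtain ⟨k', i, hk', hk'', hi⟩ := h.pull _ _ (fun i hi => hi.1) (fun i hi => hi.1) h₁ h₂ hd
      (k + 2 * τ + n)
    obtain ⟨m, rfl⟩ := Nat.exists_eq_add_of_le (show k + 2 * τ ≤ k' by omega)
    -- The pull acts at most `2 * τ` steps into the round and takes effect one step later.
    have hm : m + 1 ≤ n + (2 * τ + 1) := by omega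
    rcases hi with ⟨hi, hp⟩ | ⟨hi, hp⟩
    · have hnot := fun hmem => h.notMem_highSet_of_isPulledDown hθ hθ1 hφ hφ1 hE hhi
        (show n ≤ m by omega) hp (hH hm hmem)
      have := Set.ncard_lt_ncard ((Set.ssubset_iff_of_subset (hH hle')).2 ⟨i, hi, hnot⟩)
        (Set.toFinite _)
      omega
    · have hnot := fun hmem => h.neg.notMem_highSet_of_isPulledDown hθ hθ1 hφ hφ1 hE hlo
        (show n ≤ m by omega) hp (hL hm hmem)
      have := Set.ncard_lt_ncard ((Set.ssubset_iff_of_subset (hL hle')).2 ⟨i, hi, hnot⟩)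
        (Set.toFinite _)
      omega

/-- The range of the network contracts by a fixed factor in a fixed time. -/
theorem exists_contraction [Fintype V] (h : MixingNetwork M τ θ φ y η w) (hθ : 0 < θ)
    (hθ1 : θ ≤ 1) (hφ : 0 < φ) (hφ1 : φ ≤ 1) :
    ∃ (P : ℕ) (ρ : ℝ), 0 ≤ ρ ∧ ρ < 1 ∧ ∀ (k : ℕ) (hi lo : ℝ), lo ≤ hi →
      EventuallyLE M y η hi k → EventuallyLE M (-y) (-η) (-lo) k →
      ∃ hi' lo', lo' ≤ hi' ∧ hi' - lo' ≤ ρ * (hi - lo) ∧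
        EventuallyLE M y η hi' (k + P) ∧ EventuallyLE M (-y) (-η) (-lo') (k + P) := by
  -- `c` bounds the two cardinalities together, and each round lowers their sum. The `1` in `N` is
  -- the initial step that makes the sets disjoint.
  set c := Fintype.card V + Fintype.card V
  set N := 1 + c * (2 * τ + 1)
  set κ := θ * φ with hκ
  have hκ0 : 0 < κ := mul_pos hθ hφ
  have hκ1 : κ ≤ 1 := mul_le_one₀ hθ1 hφ.le hφ1
  have hp0 : 0 < κ ^ (N + 2 * τ) := by positivity
  have hp1 : κ ^ (N + 2 * τ) ≤ 1 := pow_le_one₀ hκ0.le hκ1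
  refine ⟨2 * τ + N, 1 - κ ^ (N + 2 * τ) / 2, by linarith, by linarith,
    fun k hi lo hle hhi hlo => ?_⟩
  have hE : 0 ≤ (hi - lo) / 2 := by linarith
  have hmul : κ ^ (N + 2 * τ) * ((hi - lo) / 2) ≤ (hi - lo) / 2 := mul_le_of_le_one_left hE hp1
  have hdisj : Disjoint (highSet M y η κ hi ((hi - lo) / 2) (k + 2 * τ) 1)
      (highSet M (-y) (-η) κ (-lo) ((hi - lo) / 2) (k + 2 * τ) 1) := by
    refine Set.disjoint_left.2 fun i hi₁ hi₂ => ?_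
    rcases le_total (w i (k + 2 * τ)) ((hi + lo) / 2) with hw | hw
    · exact h.notMem_highSet_one hθ hφ1 hE hhi (by linarith) hi₁
    · exact h.neg.notMem_highSet_one hθ hφ1 hE hlo (by simp only [Pi.neg_apply]; linarith) hi₂
  have hcard : (highSet M y η κ hi ((hi - lo) / 2) (k + 2 * τ) 1).ncard +
      (highSet M (-y) (-η) κ (-lo) ((hi - lo) / 2) (k + 2 * τ) 1).ncard ≤ c := by
    have := fun S : Set V => (Set.ncard_le_ncard (Set.subset_univ S)).trans_eq
      ((Set.ncard_univ V).trans Nat.card_eq_fintype_card)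
    exact add_le_add (this _) (this _)
  rw [← add_assoc]
  rcases h.highSet_eq_empty_or hθ hθ1 hφ hφ1 hE hhi hlo c 1 hdisj hcard with h₀ | h₀
  · refine ⟨hi - κ ^ (N + 2 * τ) * ((hi - lo) / 2), lo, by linarith, by linarith,
      h.eventuallyLE_of_highSet_eq_empty hθ hθ1 hφ hφ1 hE hhi h₀,
      fun i hi s hs => hlo i hi s (by omega)⟩
  · refine ⟨hi, lo + κ ^ (N + 2 * τ) * ((hi - lo) / 2), by linarith, by linarith,
      fun i hi s hs => hhi i hi s (by omega), ?_⟩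
    have := h.neg.eventuallyLE_of_highSet_eq_empty hθ hθ1 hφ hφ1 hE hlo h₀
    rwa [neg_sub_left, add_comm] at this

/-- All `y i` and `η i` of normal vehicles reach consensus. -/
theorem exists_range_lt [Fintype V] (h : MixingNetwork M τ θ φ y η w) (hθ : 0 < θ)
    (hθ1 : θ ≤ 1) (hφ : 0 < φ) (hφ1 : φ ≤ 1) {ε : ℝ} (hε : 0 < ε) :
    ∃ k hi lo, hi - lo < ε ∧ EventuallyLE M y η hi k ∧ EventuallyLE M (-y) (-η) (-lo) k := by
  obtain ⟨P, ρ, hρ0, hρ1, hcon⟩ := h.exists_contraction hθ hθ1 hφ hφ1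
  obtain ⟨C, hC⟩ : ∃ C, ∀ i : V, ∀ s : Fin (2 * τ + 1), |y i s| ≤ C ∧ |η i s| ≤ C := by
    obtain ⟨C, hC⟩ := (Set.finite_range fun x : V × Fin (2 * τ + 1) =>
      max |y x.1 x.2| |η x.1 x.2|).bddAbove
    exact ⟨C, fun i s => max_le_iff.1 (hC ⟨(i, s), rfl⟩)⟩
  have hC' : ∀ i s, s ≤ 2 * τ → |y i s| ≤ |C| ∧ |η i s| ≤ |C| := fun i s hs =>
    ⟨(hC i ⟨s, by omega⟩).1.trans (le_abs_self C), (hC i ⟨s, by omega⟩).2.trans (le_abs_self C)⟩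
  have hiter : ∀ n : ℕ, ∃ k hi lo, lo ≤ hi ∧ hi - lo ≤ ρ ^ n * (2 * |C|) ∧
      EventuallyLE M y η hi k ∧ EventuallyLE M (-y) (-η) (-lo) k := by
    intro n
    induction n with
    | zero =>
      refine ⟨0, |C|, -|C|, by linarith [abs_nonneg C], by linarith,
        h.eventuallyLE_of_window fun i _ s _ hs => ?_,
        h.neg.eventuallyLE_of_window fun i _ s _ hs => ?_⟩
      · obtain ⟨h₁, h₂⟩ := hC' i s (by omega)
        exact ⟨(le_abs_self _).trans h₁, (le_abs_self _).trans h₂⟩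
      · obtain ⟨h₁, h₂⟩ := hC' i s (by omega)
        rw [neg_neg]
        exact ⟨(neg_le_abs _).trans h₁, (neg_le_abs _).trans h₂⟩
    | succ n ih =>
      obtain ⟨k, hi, lo, hle, hlt, hhi, hlo⟩ := ih
      obtain ⟨hi', lo', hle', hlt', hhi', hlo'⟩ := hcon k hi lo hle hhi hlo
      refine ⟨k + P, hi', lo', hle', hlt'.trans ?_, hhi', hlo'⟩
      rw [pow_succ', mul_assoc]
      exact mul_le_mul_of_nonneg_left hlt hρ0
  have hlim : Tendsto (fun n : ℕ => ρ ^ n * (2 * |C|)) atTop (𝓝 0) := by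
    simpa using (tendsto_pow_atTop_nhds_zero_of_lt_one hρ0 hρ1).mul_const (2 * |C|)
  obtain ⟨n, hn⟩ := (hlim.eventually (gt_mem_nhds hε)).exists
  obtain ⟨k, hi, lo, -, hlt, hhi, hlo⟩ := hiter n
  exact ⟨k, hi, lo, hlt.trans_lt hn, hhi, hlo⟩

end MixingNetwork

/-! ### Coordinates in which the dynamics is a convex combination -/

/-- Under the assumptions on the gains there is a coordinate `η = y + β Q` such that the pair
`(y, η)` is updated by convex combinations with weights `e`, `b`, `g` and the remaining weight on
the input. -/
theorem exists_convex_coordinates {S A : ℝ} (hS : 0 < S) (hS1 : S < 1)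
    (h₁ : 2 * √S - S / 2 ≤ A) (h₂ : A ≤ 2 - S / 2) :
    ∃ β e b g : ℝ, 0 < β ∧ 0 ≤ e ∧ 0 < b ∧ 0 ≤ g ∧ 0 < e + g ∧ e + b = 1 - S / 2 ∧
      e + g = 1 - S / 2 - β * S ∧ 1 - A / 2 = b * β ∧ 1 - A / 2 + β - β * A = e * β := by
  obtain ⟨m, hm, rfl⟩ : ∃ m, 0 < m ∧ m ^ 2 = S := ⟨√S, Real.sqrt_pos.2 hS, Real.sq_sqrt hS.le⟩
  rw [Real.sqrt_sq hm.le] at h₁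
  have hm1 : m < 1 := by nlinarith
  -- Equal diagonal weights `e` force this value: the identities require e = b + 1 - A and e + b = 1
  -- - S / 2.
  set b := (A - m ^ 2 / 2) / 2 with hb
  have hbm : m * (1 - m / 2) ≤ b := by rw [hb]; nlinarith
  have hb0 : 0 < b := lt_of_lt_of_le (mul_pos hm (by linarith)) hbm
  have hc : 1 - A / 2 ≤ (1 - m / 2) ^ 2 := by nlinarith
  have hc0 : 0 < 1 - A / 2 := by linarith
  set β := (1 - A / 2) / b with hβ
  have hβb : b * β = 1 - A / 2 := mul_div_cancel₀ _ hb0.ne'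
  -- This amounts to `0 ≤ g`, and is what the lower bound on `A` is for; the upper bound gives `0 ≤
  -- e`.
  have hcb : (1 - A / 2) * m ^ 2 ≤ b ^ 2 := by
    have h₃ : (m * (1 - m / 2)) ^ 2 ≤ b ^ 2 :=
      pow_le_pow_left₀ (mul_nonneg hm.le (by linarith)) hbm 2
    have h₄ := mul_le_mul_of_nonneg_right hc hS.le
    linarith [mul_pow m (1 - m / 2) 2]
  have hg : 0 ≤ b - β * m ^ 2 := by
    rw [sub_nonneg, hβ, div_mul_eq_mul_div, div_le_iff₀ hb0]
    linarith
  have he : 0 ≤ 1 - m ^ 2 / 2 - b := by linarith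
  refine ⟨β, 1 - m ^ 2 / 2 - b, b, b - β * m ^ 2, div_pos hc0 hb0, he, hb0, hg, ?_, by ring,
    by ring, hβb.symm, ?_⟩
  · rcases he.lt_or_eq with he | he
    · linarith
    -- If e = 0 then `A` is at its upper limit and b = 1 - m² / 2 > m² / 2, which makes `g`
    -- positive.
    · have hlt : m ^ 2 / 2 * (m ^ 2 / 2) < b * b :=
        mul_lt_mul'' (by linarith) (by linarith) (by linarith) (by linarith)
      have hlt' : β * m ^ 2 < b := by
        rw [hβ, div_mul_eq_mul_div, div_lt_iff₀ hb0]
        have : 1 - A / 2 = m ^ 2 / 4 := by linarith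
        rw [this]
        linarith
      linarith
  · linear_combination -hβb - 2 * β * hb

theorem mixes_of_convex {θ e b g c d : ℝ} {y η w : ℕ → ℝ} (he : 0 ≤ e) (hb : 0 ≤ b) (hg : 0 ≤ g)
    (hc : e + b + c = 1) (hd : g + e + d = 1) (hθ : 0 ≤ θ) (hθb : θ ≤ e + b) (hθg : θ ≤ g + e)
    (hθc : θ ≤ c) (hθd : θ ≤ d) (hy : ∀ k, y (k + 1) = e * y k + b * η k + c * w k)
    (hη : ∀ k, η (k + 1) = g * y k + e * η k + d * w k) : Mixes θ y η w := by
  have key : ∀ {p q t Y H W B ε ε' : ℝ}, 0 ≤ p → 0 ≤ q → p + q + t = 1 → θ ≤ p + q → θ ≤ t →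
      0 ≤ ε → 0 ≤ ε' → Y ≤ B - ε → H ≤ B - ε → W ≤ B - ε' →
      p * Y + q * H + t * W ≤ B - θ * (ε + ε') := by
    intro p q t Y H W B ε ε' hp hq hsum hpq ht hε hε' hY hH hW
    have h₁ := mul_le_mul_of_nonneg_left hY hp
    have h₂ := mul_le_mul_of_nonneg_left hH hq
    have h₃ := mul_le_mul_of_nonneg_left hW (hθ.trans ht)
    have h₄ := mul_le_mul_of_nonneg_right hpq hε
    have h₅ := mul_le_mul_of_nonneg_right ht hε'
    have h₆ : (p + q + t) * B = B := by rw [hsum, one_mul]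
    linarith
  intro k B ε ε' hε hε' hyk hηk hwk
  rw [hy, hη]
  exact ⟨key he hb hc hθb hθc hε hε' hyk hηk hwk, key hg he hd hθg hθd hε hε' hyk hηk hwk⟩

/-- The double-integrator dynamics with feedback `U = S (w - y) - A Q` mixes `y` and `y + β Q`. -/
theorem exists_mixes {S A : ℝ} (hS : 0 < S) (hS1 : S < 1)
    (h₁ : 2 * √S - S / 2 ≤ A) (h₂ : A ≤ 2 - S / 2) :
    ∃ β θ : ℝ, 0 < β ∧ 0 < θ ∧ θ ≤ 1 ∧ ∀ y Q w : ℕ → ℝ,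
      (∀ k, y (k + 1) = y k + Q k + (S * (w k - y k) - A * Q k) / 2) →
      (∀ k, Q (k + 1) = Q k + (S * (w k - y k) - A * Q k)) →
      ∀ θ', 0 ≤ θ' → θ' ≤ θ → Mixes θ' y (fun k => y k + β * Q k) w := by
  obtain ⟨β, e, b, g, hβ, he, hb, hg, heg, h₃, h₄, h₅, h₆⟩ :=
    exists_convex_coordinates hS hS1 h₁ h₂
  have hβS := mul_pos hβ hS
  refine ⟨β, min (min (e + b) (g + e)) (S / 2), hβ,
    lt_min (lt_min (by linarith) (by linarith)) (by linarith),
    (min_le_right _ _).trans (by linarith), fun y Q w hy hQ θ' hθ' hle => ?_⟩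
  obtain ⟨hle, hle₃⟩ := le_min_iff.1 hle
  obtain ⟨hle₁, hle₂⟩ := le_min_iff.1 hle
  refine mixes_of_convex (c := S / 2) (d := S / 2 + β * S) he hb.le hg (by linarith) (by linarith)
    hθ' hle₁ hle₂ hle₃ (by linarith) (fun k => ?_) fun k => ?_
  · rw [hy]
    linear_combination (Q k) * h₅ - (y k) * h₃
  · rw [hy, hQ]
    linear_combination (Q k) * h₆ - (y k) * h₄

theorem exists_pos_le {ι : Type*} [Finite ι] (x : ι → ℝ) (hx : ∀ i, 0 < x i) :
    ∃ c, 0 < c ∧ c ≤ 1 ∧ ∀ i, c ≤ x i := by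
  cases isEmpty_or_nonempty ι
  · exact ⟨1, one_pos, le_rfl, fun i => isEmptyElim i⟩
  · obtain ⟨i, hi⟩ := Finite.exists_min x
    exact ⟨min (x i) 1, lt_min (hx i) one_pos, min_le_right _ _,
      fun j => (min_le_left _ _).trans (hi j)⟩

/-! ### Limits, and reduction of the vehicle network to a mixing network -/

/-- If the ranges of `y` and `η = y + β Q` shrink to a point then `y` reaches consensus and `Q`
vanishes. -/
theorem MixingNetwork.tendsto {V : Type*} [Fintype V] {M : Finset V} {τ : ℕ} {θ φ : ℝ}
    {y Q w : V → ℕ → ℝ} {β : V → ℝ} (hβ : ∀ i, 0 < β i)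
    (h : MixingNetwork M τ θ φ y (fun i k => y i k + β i * Q i k) w) (hθ : 0 < θ)
    (hθ1 : θ ≤ 1) (hφ : 0 < φ) (hφ1 : φ ≤ 1) :
    (∀ i j, i ∉ M → j ∉ M → Tendsto (fun k => y j k - y i k) atTop (𝓝 0)) ∧
      ∀ i, i ∉ M → Tendsto (fun k => Q i k) atTop (𝓝 0) := by
  constructor
  · intro i j hi hj
    refine Metric.tendsto_atTop.2 fun ε hε => ?_
    obtain ⟨k, B, C, hlt, hB, hC⟩ := h.exists_range_lt hθ hθ1 hφ hφ1 hε
    refine ⟨k, fun s hs => ?_⟩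
    have h₁ := (hB i hi s hs).1
    have h₂ := (hB j hj s hs).1
    have h₃ := (hC i hi s hs).1
    have h₄ := (hC j hj s hs).1
    simp only [Pi.neg_apply] at h₃ h₄
    rw [Real.dist_eq, sub_zero, abs_lt]
    constructor <;> linarith
  · intro i hi
    refine Metric.tendsto_atTop.2 fun ε hε => ?_
    obtain ⟨k, B, C, hlt, hB, hC⟩ := h.exists_range_lt hθ hθ1 hφ hφ1 (mul_pos (hβ i) hε)
    refine ⟨k, fun s hs => ?_⟩
    obtain ⟨h₁, h₂⟩ := hB i hi s hs
    obtain ⟨h₃, h₄⟩ := hC i hi s hs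
    simp only [Pi.neg_apply] at h₃ h₄
    rw [Real.dist_eq, sub_zero]
    refine lt_of_mul_lt_mul_left ?_ (hβ i).le
    rw [← abs_of_pos (hβ i), ← abs_mul, abs_of_pos (hβ i), abs_lt]
    constructor <;> linarith

/-- In coordinates in which the desired relative positions vanish, a run is a filtered run. -/
theorem Execution.IsADPMSR.filteredRun {V : Type*} [Fintype V] {E : Execution V}
    {G : ℕ → Digraph V} {M : Finset V} {f τ : ℕ} {T r : ℝ} {α : V → ℝ} {δ : V → V → ℝ}
    (hE : E.IsADPMSR G M f τ T r α δ) {d : V → ℝ} (hd : ∀ i j, δ i j = d j - d i) :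
    FilteredRun G M f τ E.updates E.delay E.kept (fun i k => E.p T r i k - d i)
      (fun i j k => E.data i j k - d j) where
  received i hi k hk j hj hjM := by
    obtain ⟨h₁, h₂, h₃⟩ := (hE.update i hi k hk).1 j hj hjM
    exact ⟨h₁, h₂, by rw [h₃]⟩
  filtered i hi k hk := by
    have heq : (fun j => E.data i j k - d j - (E.p T r i k - d i)) =
        fun j => E.data i j k - E.p T r i k - δ i j := by
      funext j
      rw [hd]
      ring
    rw [heq]
    exact (hE.update i hi k hk).2
  hold i hi k hk := by
    obtain ⟨h₁, h₂⟩ := hE.hold i hi k hk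
    exact ⟨h₁, fun j hj => by rw [h₂ j hj]⟩

/-- The window of links starts at `k + τ`, so that the update using them sees only data from time
`k` on, when the vehicles outside `S` are already low. -/
theorem FilteredRun.exists_isPulledDown {V : Type*} [Fintype V] {G : ℕ → Digraph V}
    {M : Finset V} {f τ ℓ : ℕ} {updates : V → Set ℕ} {delay : V → V → ℕ → ℕ}
    {kept : V → ℕ → Finset V} {y : V → ℕ → ℝ} {dat : V → V → ℕ → ℝ}
    (h : FilteredRun G M f τ updates delay kept y dat)
    (hM : IsFLocal G τ f M) {a : V → V → ℕ → ℝ} {σ : V → ℝ} (hσ : ∀ i, 0 < σ i) {γ φ : ℝ}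
    (hγ : 0 < γ) (hφ : ∀ i, φ ≤ γ / σ i) (hφ1 : φ ≤ 1)
    (ha : ∀ i, i ∉ M → ∀ k, ∀ j ∈ kept i k, γ ≤ a i j k)
    (hs : ∀ i, i ∉ M → ∀ k, ∑ j ∈ kept i k, a i j k ≤ σ i)
    (hℓ : 1 ≤ ℓ) (hup : ∀ i, i ∉ M → ∀ t, ∃ k ∈ updates i, t + ℓ ≤ k + 1 ∧ k ≤ t + τ)
    {S : Set V} {k : ℕ} {i : V} (hi : i ∉ M)
    (hadj : 2 * f + 1 ≤ {j | j ∉ S ∧ (unionOver G (k + τ) ℓ).Adj j i}.ncard) :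
    ∃ k', k ≤ k' ∧ k' ≤ k + 2 * τ ∧ IsPulledDown M τ φ y (fun i k =>
      weightedAverage (σ i) (kept i k) (fun j => a i j k) (fun j => dat i j k) (y i k))
      S k k' i := by
  obtain ⟨k', hk', hle, hle'⟩ := hup i hi (k + τ)
  obtain ⟨Q, hQN, hQ, hQS⟩ := exists_subset_neighborsAt hadj hle hle'
  exact ⟨k', by omega, by omega, h.isPulledDown hM hσ hγ hφ hφ1 ha hs (by omega) hi hk' hQN hQ hQS⟩

theorem corollary2 {V : Type*} [Fintype V] (G : ℕ → Digraph V) (f ℓ τ : ℕ)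
    (hℓ : 1 ≤ ℓ) (hℓτ : ℓ ≤ τ) (hG : IsJointlyRobust G (2 * f + 1) ℓ)
    (T r γ : ℝ) (α σ : V → ℝ) (δ : V → V → ℝ)
    (hT : 0 < T) (hγ : 0 < γ) (hσ : ∀ i, 0 < σ i) (hTσ : ∀ i, T ^ 2 * σ i < 1)
    (hα : ∀ i, 2 * √(σ i) - T * σ i / 2 ≤ α i ∧ α i ≤ 2 / T - T * σ i / 2)
    (hδ : ∀ i j k, δ i j + δ j k = δ i k)
    (M : Finset V) (hM : IsFTotal f M ∨ IsFLocal G τ f M)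
    (E : Execution V) (hE : E.IsADPMSR G M f τ T r α δ)
    (hw : E.WeightsBounded M γ σ) (hasync : E.PartiallyAsynchronous M ℓ τ) :
    E.CoordinatedMovement M δ r := by
  cases isEmpty_or_nonempty V
  · exact ⟨fun i => isEmptyElim i, fun i => isEmptyElim i⟩
  obtain ⟨o⟩ := ‹Nonempty V›
  have hd : ∀ i j, δ i j = δ o j - δ o i := fun i j => by linarith [hδ o i j]
  have hloc : IsFLocal G τ f M := hM.elim IsFTotal.isFLocal id
  have hrun := hE.filteredRun hd
  set y : V → ℕ → ℝ := fun i k => E.p T r i k - δ o i with hy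
  set dat : V → V → ℕ → ℝ := fun i j k => E.data i j k - δ o j with hdat
  set Q : V → ℕ → ℝ := fun i k => T * E.q r i k with hQ
  set w : V → ℕ → ℝ := fun i k => weightedAverage (σ i) (E.kept i k) (fun j => E.a i j k)
    (fun j => dat i j k) (y i k) with hwdef
  have hmix : ∀ i, ∃ β θ : ℝ, 0 < β ∧ 0 < θ ∧ θ ≤ 1 ∧ ∀ y Q w : ℕ → ℝ,
      (∀ k, y (k + 1) = y k + Q k + (T ^ 2 * σ i * (w k - y k) - T * α i * Q k) / 2) →
      (∀ k, Q (k + 1) = Q k + (T ^ 2 * σ i * (w k - y k) - T * α i * Q k)) →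
      ∀ θ', 0 ≤ θ' → θ' ≤ θ → Mixes θ' y (fun k => y k + β * Q k) w := by
    intro i
    obtain ⟨h₁, h₂⟩ := hα i
    refine exists_mixes (mul_pos (pow_pos hT 2) (hσ i)) (hTσ i) ?_ ?_
    · rw [Real.sqrt_mul (sq_nonneg T), Real.sqrt_sq hT.le]
      linarith [mul_le_mul_of_nonneg_left h₁ hT.le]
    · have := mul_le_mul_of_nonneg_left h₂ hT.le
      rw [mul_sub, mul_div_cancel₀ _ hT.ne'] at this
      linarith
  choose β θ₀ hβ hθ₀ hθ₀1 hmix using hmix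
  obtain ⟨θ, hθ, hθ1, hθle⟩ := exists_pos_le θ₀ hθ₀
  obtain ⟨φ, hφ, hφ1, hφle⟩ := exists_pos_le (fun i => γ / σ i) fun i => div_pos hγ (hσ i)
  -- The weight left over in `w i` sits on `y i`, so σ_i (w_i - y_i) is exactly the filtered sum in
  -- the control law.
  have hU : ∀ i, i ∉ M → ∀ k, T ^ 2 * E.u i k =
      T ^ 2 * σ i * (w i k - y i k) - T * α i * Q i k := by
    intro i hi k
    have h₁ : σ i * w i k = (σ i - ∑ j ∈ E.kept i k, E.a i j k) * y i k +
        ∑ j ∈ E.kept i k, E.a i j k * dat i j k := mul_div_cancel₀ _ (hσ i).ne'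
    have h₂ : ∑ j ∈ E.kept i k, E.a i j k * (E.data i j k - E.p T r i k - δ i j) =
        ∑ j ∈ E.kept i k, E.a i j k * dat i j k - (∑ j ∈ E.kept i k, E.a i j k) * y i k := by
      rw [Finset.sum_mul, ← Finset.sum_sub_distrib]
      refine Finset.sum_congr rfl fun j _ => ?_
      rw [hd i j]
      simp only [hdat, hy]
      ring
    rw [hE.control i hi k, h₂]
    simp only [hQ]
    linear_combination -T ^ 2 * h₁
  have hyrec : ∀ i, i ∉ M → ∀ k, y i (k + 1) =
      y i k + Q i k + (T ^ 2 * σ i * (w i k - y i k) - T * α i * Q i k) / 2 := by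
    intro i hi k
    rw [← hU i hi k]
    simp only [hy, hQ, Execution.p, Execution.q, (hE.dynamics i k).1]
    push_cast
    ring
  have hQrec : ∀ i, i ∉ M → ∀ k, Q i (k + 1) =
      Q i k + (T ^ 2 * σ i * (w i k - y i k) - T * α i * Q i k) := by
    intro i hi k
    rw [← hU i hi k]
    simp only [hQ, Execution.q, (hE.dynamics i k).2]
    ring
  have hup : ∀ i, i ∉ M → ∀ t, ∃ k ∈ E.updates i, t ≤ k ∧ k ≤ t + τ := fun i hi t => by
    obtain ⟨k, hk, h₁, h₂⟩ := hasync i hi t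
    exact ⟨k, hk, by omega, h₂⟩
  have ha : ∀ i, i ∉ M → ∀ k, ∀ j ∈ E.kept i k, γ ≤ E.a i j k := fun i hi k => (hw i hi k).1
  have ha0 : ∀ i, i ∉ M → ∀ k, ∀ j ∈ E.kept i k, 0 ≤ E.a i j k :=
    fun i hi k j hj => hγ.le.trans (ha i hi k j hj)
  have hs : ∀ i, i ∉ M → ∀ k, ∑ j ∈ E.kept i k, E.a i j k ≤ σ i := fun i hi k => (hw i hi k).2
  have hwneg : (fun i k => weightedAverage (σ i) (E.kept i k) (fun j => E.a i j k)
      (fun j => (-dat) i j k) ((-y) i k)) = -w := by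
    funext i k
    exact weightedAverage_neg _ _ _ _ _
  have hnet : MixingNetwork M τ θ φ y (fun i k => y i k + β i * Q i k) w := by
    refine ⟨fun i hi => hmix i _ _ _ (hyrec i hi) (hQrec i hi) θ hθ.le (hθle i), fun i hi => ?_,
      hrun.safeAbove hloc hσ ha0 hs hup, hwneg ▸ hrun.neg.safeAbove hloc hσ ha0 hs hup, ?_⟩
    · have hη : (-fun k => y i k + β i * Q i k) = fun k => (-y i) k + β i * (-Q i) k := by
        funext k
        simp only [Pi.neg_apply]
        ring
      rw [hη]
      refine hmix i _ _ _ (fun k => ?_) (fun k => ?_) θ hθ.le (hθle i)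
      · simp only [Pi.neg_apply, hyrec i hi k]
        ring
      · simp only [Pi.neg_apply, hQrec i hi k]
        ring
    · intro S₁ S₂ hS₁ hS₂ hn₁ hn₂ hdisj k
      rcases (hG (k + τ)).exists_mem hn₁ hn₂ hdisj with ⟨i, hi, hadj⟩ | ⟨i, hi, hadj⟩
      · obtain ⟨k', hk, hk', hp⟩ := hrun.exists_isPulledDown hloc hσ hγ hφle hφ1 ha hs hℓ hasync
          (hS₁ hi) hadj
        exact ⟨k', i, hk, hk', Or.inl ⟨hi, hp⟩⟩
      · obtain ⟨k', hk, hk', hp⟩ := hrun.neg.exists_isPulledDown hloc hσ hγ hφle hφ1 ha hs hℓ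
          hasync (hS₂ hi) hadj
        exact ⟨k', i, hk, hk', Or.inr ⟨hi, hwneg ▸ hp⟩⟩
  obtain ⟨hlim, hlimQ⟩ := hnet.tendsto hβ hθ hθ1 hφ hφ1
  refine ⟨fun i j hi hj => ?_, fun i hi => ?_⟩
  · have h₁ := (hlim i j hi hj).add_const (δ i j)
    rw [zero_add] at h₁
    refine h₁.congr fun k => ?_
    rw [hd i j]
    simp only [hy, Execution.p]
    ring
  · have h₁ := ((hlimQ i hi).const_mul T⁻¹).add_const r
    rw [mul_zero, zero_add] at h₁
    refine h₁.congr fun k => ?_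
    simp only [hQ, Execution.q]
    rw [inv_mul_cancel_left₀ hT.ne']
    ring
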